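/- For a function $f(z)=\sum_{n=0}^\infty a_nz^n$ analytic in the open unit disk $\mathbb D$, let $\mathcal M_f(r)=\sum_{n=0}^\infty |a_n|r^n$ $(0\le r<1)$ denote its majorant series, and for $x\in(0,1)$ put $$r_x:=\frac{\sqrt{(1+x)^2+x^2}-(1+x)}{x^2}.$$ The equation $x^4+2x^2+2x-1=0$ has exactly one root $\tilde a$ in $(0,1)$, and $\tilde a\approx 0.361103$ (correct to six decimals: $|\tilde a-0.361103|<5\cdot 10^{-7}$). Let $f:\mathbb D\to\mathbb D$ be an analytic function with Taylor expansion $f(z)=\sum_{n=0}^\infty a_nz^n$ and $|a_0|\ge\tilde a$. Then $$|f(z)|+\mathcal M_f(r)-|a_0|\le 1\qquad\text{for all } |z|=r\le r_{|a_0|}.$$ The radius $r_{|a_0|}$ is sharp: for every $a\in\mathbb C$ with $\tilde a\le |a|<1$ one has $0<r_{|a|}<1$, and there is an analytic function $f:\mathbb D\to\mathbb D$ with $f(0)=a_0=a$ such that for every $r\in(r_{|a|},1)$ there is a $z$ with $|z|=r$ and $|f(z)|+\mathcal M_f(r)-|a_0|>1$. -/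

import Mathlib

namespace BohrIneq

/-- The `n`-th Taylor coefficient at the origin of a function analytic near the origin. -/
noncomputable def taylorCoeff (f : ℂ → ℂ) (n : ℕ) : ℂ :=
  iteratedDeriv n f 0 / (n.factorial : ℂ)

/-- The majorant series `∑ |a_n| r ^ n` of `f`, where `a_n` are the Taylor coefficients of `f` at
the origin. -/
noncomputable def majorant (f : ℂ → ℂ) (r : ℝ) : ℝ :=
  ∑' n : ℕ, ‖taylorCoeff f n‖ * r ^ n

/-- `f` restricts to an analytic map of the open unit disk into itself. -/
def IsAnalyticSelfMap (f : ℂ → ℂ) : Prop :=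
  AnalyticOnNhd ℂ f (Metric.ball 0 1) ∧ Set.MapsTo f (Metric.ball 0 1) (Metric.ball 0 1)

/-- The radius `(√((1 + x)² + x²) - (1 + x)) / x²`. -/
noncomputable def radius (x : ℝ) : ℝ :=
  (Real.sqrt ((1 + x) ^ 2 + x ^ 2) - (1 + x)) / x ^ 2

end BohrIneq

open Metric Set Filter Topology ComplexConjugate

namespace BohrIneq

/-! Write x = |a_0|. Schwarz–Pick gives |f(z)| ≤ (x + r)/(1 + xr) (`norm_mul_le`), and for r ≤ x the
tail of the majorant series is at most r(1 - x²)/(1 - xr) (`sum_taylorCoeff_succ_le`). The tail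
bound comes from a weighted ℓ² estimate, got by averaging squared Schwarz–Pick over a circle,
followed by Cauchy–Schwarz.

By `one_sub_extremal_sum`, these two bounds add up to at most 1 exactly when x²r² + 2(1 + x)r ≤ 1,
that is, r ≤ `radius x`. The condition |a_0| ≥ t serves only to ensure `radius x ≤ x`, so that the
tail bound applies. A disk automorphism attains both bounds at z = -r, hence sharpness. -/

theorem taylorCoeff_zero (f : ℂ → ℂ) : taylorCoeff f 0 = f 0 := by simp [taylorCoeff]

/-! ### Taylor coefficients and Bessel's inequality on a circle -/

theorem taylorCoeff_eq_of_hasFPowerSeriesAt {f : ℂ → ℂ} {p : FormalMultilinearSeries ℂ ℂ ℂ}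
    (hp : HasFPowerSeriesAt f p 0) (n : ℕ) : taylorCoeff f n = p.coeff n := by
  rw [hp.eq_formalMultilinearSeries hp.analyticAt.hasFPowerSeriesAt,
    FormalMultilinearSeries.coeff_ofScalars]
  rfl

theorem taylorCoeff_eq_of_hasSum {f : ℂ → ℂ} {c : ℕ → ℂ}
    (h : ∀ᶠ z in 𝓝 (0 : ℂ), HasSum (fun n => c n * z ^ n) (f z)) (n : ℕ) :
    taylorCoeff f n = c n := by
  have hp : HasFPowerSeriesAt f (FormalMultilinearSeries.ofScalars ℂ c) 0 := by
    rw [hasFPowerSeriesAt_iff]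
    simpa [FormalMultilinearSeries.coeff_ofScalars, mul_comm] using h
  rw [taylorCoeff_eq_of_hasFPowerSeriesAt hp, FormalMultilinearSeries.coeff_ofScalars]

theorem taylorCoeff_eq_circleAverage {f : ℂ → ℂ} {s : ℝ} (hs : 0 < s)
    (hf : DifferentiableOn ℂ f (closedBall 0 s)) (m : ℕ) :
    taylorCoeff f m = Real.circleAverage (fun z => f z * z⁻¹ ^ m) 0 s := by
  lift s to NNReal using hs.le
  have hp := (hf.hasFPowerSeriesOnBall (NNReal.coe_pos.1 hs)).hasFPowerSeriesAt
  rw [taylorCoeff_eq_of_hasFPowerSeriesAt hp, Real.circleAverage_eq_circleIntegral hs.ne']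
  change cauchyPowerSeries f 0 s m (fun _ => 1) = _
  rw [cauchyPowerSeries_apply]
  simp only [sub_zero, one_div, smul_eq_mul]
  congr 2
  ext z
  ring

theorem circleAverage_const_mul (a : ℂ) (f : ℂ → ℂ) (c : ℂ) (R : ℝ) :
    Real.circleAverage (fun z => a * f z) c R = a * Real.circleAverage f c R :=
  Real.circleAverage_fun_smul (a := a)

theorem circleAverage_pow_mul_inv_pow {s : ℝ} (hs : 0 < s) (k m : ℕ) :
    Real.circleAverage (fun z : ℂ => z ^ k * z⁻¹ ^ m) 0 s = if k = m then 1 else 0 := by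
  split_ifs with h
  · subst h
    rw [← Real.circleAverage_const (1 : ℂ) 0 s]
    refine Real.circleAverage_congr_sphere fun z hz => ?_
    have : z ≠ 0 := by
      rintro rfl
      simp [abs_of_pos hs, hs.ne] at hz
    simp [this]
  · rw [Real.circleAverage_eq_circleIntegral hs.ne']
    have : (∮ z in C(0, s), (z - 0)⁻¹ • (z ^ k * z⁻¹ ^ m)) =
        ∮ z in C(0, s), (z - 0) ^ ((k : ℤ) - m - 1) := by
      refine circleIntegral.integral_congr hs.le fun z hz => ?_
      have : z ≠ 0 := by
        rintro rfl
        simp [hs.ne] at hz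
      simp only [sub_zero, smul_eq_mul]
      rw [zpow_sub₀ this, zpow_sub₀ this]
      simp only [zpow_natCast, zpow_one, inv_pow]
      field_simp
    rw [this, circleIntegral.integral_sub_zpow_of_ne (by omega), smul_zero]

/-- Bessel's inequality: average |f - P|² ≥ 0 over the circle, P being the part of the Taylor series
indexed by `S`. Since conj z = s²/z there, conj P is the polynomial Q in 1/z, and averaging against
Q extracts Taylor coefficients. -/
theorem sum_sq_taylorCoeff_le_circleAverage {f : ℂ → ℂ} {s : ℝ} (hs : 0 < s)
    (hf : DifferentiableOn ℂ f (closedBall 0 s)) (S : Finset ℕ) :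
    ∑ m ∈ S, ‖taylorCoeff f m‖ ^ 2 * (s ^ 2) ^ m ≤
      Real.circleAverage (fun z => ‖f z‖ ^ 2) 0 s := by
  have hne : ∀ z ∈ sphere (0 : ℂ) s, z ≠ 0 := by
    rintro z hz rfl
    simp [hs.ne] at hz
  have hc : ContinuousOn f (sphere 0 s) := hf.continuousOn.mono sphere_subset_closedBall
  have hinv : ContinuousOn (fun z : ℂ => z⁻¹) (sphere 0 s) := continuousOn_inv₀.mono hne
  set c := taylorCoeff f
  set P : ℂ → ℂ := fun z => ∑ m ∈ S, c m * z ^ m with hP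
  set Q : ℂ → ℂ := fun z => ∑ m ∈ S, conj (c m) * (s ^ 2 : ℂ) ^ m * z⁻¹ ^ m with hQ
  have hPc : ContinuousOn P (sphere 0 s) := by rw [hP]; fun_prop
  have hQc : ContinuousOn Q (sphere 0 s) := by rw [hQ]; fun_prop
  have hconj : ∀ z ∈ sphere (0 : ℂ) s, Q z = conj (P z) := by
    intro z hz
    have h1 : (s ^ 2 : ℂ) * z⁻¹ = conj z := by
      have : (s ^ 2 : ℂ) = z * conj z := by
        rw [Complex.mul_conj, Complex.normSq_eq_norm_sq, mem_sphere_zero_iff_norm.1 hz]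
        push_cast; rfl
      rw [this]
      field_simp [hne z hz]
    simp only [hP, hQ, map_sum, map_mul, map_pow, mul_assoc, ← mul_pow, h1]
  have havg : ∀ g : ℂ → ℂ, ContinuousOn g (sphere 0 s) →
      Real.circleAverage (fun z => g z * Q z) 0 s =
        ∑ m ∈ S, conj (c m) * (s ^ 2 : ℂ) ^ m *
          Real.circleAverage (fun z => g z * z⁻¹ ^ m) 0 s := by
    intro g hg
    simp only [hQ, Finset.mul_sum]
    rw [Real.circleAverage_fun_sum fun i _ => ContinuousOn.circleIntegrable hs.le (by fun_prop)]
    refine Finset.sum_congr rfl fun m _ => ?_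
    rw [← circleAverage_const_mul]
    congr 1
    ext z
    ring
  have hval : ∀ m, conj (c m) * (s ^ 2 : ℂ) ^ m * c m
      = ((‖c m‖ ^ 2 * (s ^ 2) ^ m : ℝ) : ℂ) := by
    intro m
    have := Complex.mul_conj (c m)
    rw [Complex.normSq_eq_norm_sq] at this
    push_cast at this ⊢
    rw [← this]
    ring
  have hf1 : Real.circleAverage (fun z => f z * Q z) 0 s =
      ((∑ m ∈ S, ‖c m‖ ^ 2 * (s ^ 2) ^ m : ℝ) : ℂ) := by
    rw [havg f hc, Complex.ofReal_sum]
    refine Finset.sum_congr rfl fun m _ => ?_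
    rw [← taylorCoeff_eq_circleAverage hs hf m, ← hval]
  have hP1 : Real.circleAverage (fun z => P z * Q z) 0 s =
      ((∑ m ∈ S, ‖c m‖ ^ 2 * (s ^ 2) ^ m : ℝ) : ℂ) := by
    rw [havg P hPc, Complex.ofReal_sum]
    refine Finset.sum_congr rfl fun m hm => ?_
    have : Real.circleAverage (fun z => P z * z⁻¹ ^ m) 0 s = c m := by
      simp only [hP, Finset.sum_mul]
      rw [Real.circleAverage_fun_sum fun i _ => ContinuousOn.circleIntegrable hs.le (by fun_prop)]
      have : ∀ i ∈ S, Real.circleAverage (fun z => c i * z ^ i * z⁻¹ ^ m) 0 s =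
          if i = m then c i else 0 := by
        intro i _
        simp only [mul_assoc]
        rw [circleAverage_const_mul, circleAverage_pow_mul_inv_pow hs]
        simp
      rw [Finset.sum_congr rfl this]
      simp [hm]
    rw [this, hval]
  -- On the circle the integrand equals |f|² - |f - P|².
  have hre : Real.circleAverage (fun z => (2 * (f z * Q z) - P z * Q z).re) 0 s =
      ∑ m ∈ S, ‖c m‖ ^ 2 * (s ^ 2) ^ m := by
    have h1 := Complex.reCLM.circleAverage_comp_comm (c := 0) (R := s)
      (f := fun z => 2 * (f z * Q z) - P z * Q z)
      (ContinuousOn.circleIntegrable hs.le (by fun_prop))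
    rw [Real.circleAverage_fun_sub (ContinuousOn.circleIntegrable hs.le (by fun_prop))
      (ContinuousOn.circleIntegrable hs.le (by fun_prop)), circleAverage_const_mul, hf1, hP1] at h1
    refine h1.trans ?_
    rw [Complex.reCLM_apply, Complex.sub_re, Complex.re_mul_ofReal, Complex.ofReal_re]
    norm_num
    ring
  rw [← hre]
  refine Real.circleAverage_mono (ContinuousOn.circleIntegrable hs.le (by fun_prop))
    (ContinuousOn.circleIntegrable hs.le (by fun_prop)) fun z hz => ?_
  rw [abs_of_pos hs] at hz
  rw [hconj z hz, Complex.sq_norm, Complex.normSq_apply]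
  simp only [Complex.sub_re, Complex.mul_re, Complex.conj_re, Complex.conj_im, Complex.re_ofNat,
    Complex.im_ofNat]
  nlinarith [sq_nonneg ((f z).re - (P z).re), sq_nonneg ((f z).im - (P z).im)]

/-! ### Schwarz–Pick at the origin -/

theorem sq_norm_sub_eq (w b : ℂ) :
    ‖w - b‖ ^ 2 = ‖w‖ ^ 2 + ‖b‖ ^ 2 - 2 * (conj b * w).re := by
  simp only [Complex.sq_norm, Complex.normSq_apply, Complex.sub_re, Complex.sub_im,
    Complex.mul_re, Complex.conj_re, Complex.conj_im]
  ring

theorem sq_norm_one_sub_conj_mul_eq (w b : ℂ) :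
    ‖1 - conj b * w‖ ^ 2 = 1 + ‖b‖ ^ 2 * ‖w‖ ^ 2 - 2 * (conj b * w).re := by
  simp only [Complex.sq_norm, Complex.normSq_apply, Complex.sub_re, Complex.sub_im,
    Complex.mul_re, Complex.mul_im, Complex.conj_re, Complex.conj_im, Complex.one_re,
    Complex.one_im]
  ring

theorem one_sub_conj_mul_ne_zero {w b : ℂ} (hw : ‖w‖ < 1) (hb : ‖b‖ < 1) :
    1 - conj b * w ≠ 0 := by
  intro h
  have h1 : ‖conj b * w‖ = 1 := by rw [← sub_eq_zero.1 h, norm_one]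
  rw [norm_mul, Complex.norm_conj] at h1
  nlinarith [norm_nonneg w, norm_nonneg b]

theorem norm_sub_lt_norm_one_sub_conj_mul {w b : ℂ} (hw : ‖w‖ < 1) (hb : ‖b‖ < 1) :
    ‖w - b‖ < ‖1 - conj b * w‖ := by
  refine lt_of_pow_lt_pow_left₀ 2 (norm_nonneg _) ?_
  rw [sq_norm_sub_eq, sq_norm_one_sub_conj_mul_eq]
  have h1 : ‖w‖ ^ 2 < 1 := by nlinarith [norm_nonneg w]
  have h2 : ‖b‖ ^ 2 < 1 := by nlinarith [norm_nonneg b]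
  nlinarith

theorem IsAnalyticSelfMap.norm_lt_one {f : ℂ → ℂ} (hf : IsAnalyticSelfMap f) {z : ℂ}
    (hz : ‖z‖ < 1) : ‖f z‖ < 1 := by
  simpa using hf.2 (mem_ball_zero_iff.2 hz)

/-- The Schwarz–Pick inequality based at the origin. -/
theorem IsAnalyticSelfMap.norm_sub_le {f : ℂ → ℂ} (hf : IsAnalyticSelfMap f) {z : ℂ}
    (hz : ‖z‖ < 1) : ‖f z - f 0‖ ≤ ‖z‖ * ‖1 - conj (f 0) * f z‖ := by
  have h0 : ‖f 0‖ < 1 := hf.norm_lt_one (by simp)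
  have hne : ∀ w ∈ ball (0 : ℂ) 1, 1 - conj (f 0) * f w ≠ 0 := fun w hw =>
    one_sub_conj_mul_ne_zero (hf.norm_lt_one (mem_ball_zero_iff.1 hw)) h0
  have hd : DifferentiableOn ℂ f (ball 0 1) := hf.1.differentiableOn
  have := Complex.norm_le_norm_of_mapsTo_ball (R := 1) (z := z)
    (f := fun w => (f w - f 0) / (1 - conj (f 0) * f w))
    ((hd.sub_const _).div ((hd.const_mul _).const_sub _) hne)
    (fun w hw => by
      rw [mem_closedBall_zero_iff, norm_div]
      exact div_le_one_of_le₀ (norm_sub_lt_norm_one_sub_conj_mul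
        (hf.norm_lt_one (mem_ball_zero_iff.1 hw)) h0).le (norm_nonneg _)) (by simp) hz
  rwa [norm_div, div_le_iff₀ (norm_pos_iff.2 (hne z (mem_ball_zero_iff.2 hz)))] at this

theorem IsAnalyticSelfMap.norm_mul_le {f : ℂ → ℂ} (hf : IsAnalyticSelfMap f) {z : ℂ}
    (hz : ‖z‖ < 1) : ‖f z‖ * (1 + ‖f 0‖ * ‖z‖) ≤ ‖f 0‖ + ‖z‖ := by
  have h := pow_le_pow_left₀ (norm_nonneg _) (hf.norm_sub_le hz) 2
  rw [mul_pow, sq_norm_sub_eq, sq_norm_one_sub_conj_mul_eq] at h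
  have h0 : ‖f 0‖ < 1 := hf.norm_lt_one (by simp)
  have h1 := hf.norm_lt_one hz
  have hre : (conj (f 0) * f z).re ≤ ‖f 0‖ * ‖f z‖ := by
    simpa using Complex.re_le_norm (conj (f 0) * f z)
  have hz2 : 0 ≤ 1 - ‖z‖ ^ 2 := by nlinarith [norm_nonneg z]
  have h2 : (‖f z‖ - ‖f 0‖) ^ 2 ≤ (‖z‖ * (1 - ‖f 0‖ * ‖f z‖)) ^ 2 := by
    nlinarith [mul_le_mul_of_nonneg_left hre hz2]
  have h3 : 0 ≤ ‖z‖ * (1 - ‖f 0‖ * ‖f z‖) := by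
    refine mul_nonneg (norm_nonneg _) ?_
    nlinarith [norm_nonneg (f 0), norm_nonneg (f z)]
  have := abs_le_of_sq_le_sq h2 h3
  linarith [(abs_le.1 this).2]

/-! ### Bounds for the tail of the majorant series -/

/-- Squared Schwarz–Pick is linear in |f|² and Re(conj a_0 · f). Averaging it, with the mean value
property for the second term, bounds the mean of |f|²; Bessel then bounds the coefficients. -/
theorem IsAnalyticSelfMap.sum_sq_taylorCoeff_succ_le {f : ℂ → ℂ} (hf : IsAnalyticSelfMap f)
    {s : ℝ} (hs : 0 < s) (hs1 : s < 1) (N : ℕ) :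
    (∑ m ∈ Finset.range N, ‖taylorCoeff f (m + 1)‖ ^ 2 * (s ^ 2) ^ (m + 1)) *
      (1 - ‖f 0‖ ^ 2 * s ^ 2) ≤ s ^ 2 * (1 - ‖f 0‖ ^ 2) ^ 2 := by
  have hd : DifferentiableOn ℂ f (closedBall 0 s) :=
    hf.1.differentiableOn.mono (closedBall_subset_ball hs1)
  have hc : ContinuousOn f (sphere 0 s) := hd.continuousOn.mono sphere_subset_closedBall
  have h0 : ‖f 0‖ < 1 := hf.norm_lt_one (by simp)
  have hB := sum_sq_taylorCoeff_le_circleAverage hs hd (Finset.range (N + 1))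
  rw [Finset.sum_range_succ', taylorCoeff_zero, pow_zero, mul_one] at hB
  have hmean : Real.circleAverage (fun z => (conj (f 0) * f z).re) 0 s = ‖f 0‖ ^ 2 := by
    have h1 := Complex.reCLM.circleAverage_comp_comm (c := 0) (R := s)
      (f := fun z => conj (f 0) * f z) (ContinuousOn.circleIntegrable hs.le (by fun_prop))
    have h2 : Real.circleAverage f 0 s = f 0 := by
      refine DiffContOnCl.circleAverage (DifferentiableOn.diffContOnCl ?_)
      rw [abs_of_pos hs]
      exact hd.mono closure_ball_subset_closedBall
    rw [circleAverage_const_mul, h2, mul_comm, Complex.mul_conj, Complex.normSq_eq_norm_sq] at h1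
    exact h1
  set A := Real.circleAverage (fun z => ‖f z‖ ^ 2) 0 s with hA
  have hcomb : ∀ α β γ : ℝ, Real.circleAverage
      (fun z => α + β * ‖f z‖ ^ 2 + γ * (conj (f 0) * f z).re) 0 s
        = α + β * A + γ * ‖f 0‖ ^ 2 := by
    intro α β γ
    rw [Real.circleAverage_fun_add (ContinuousOn.circleIntegrable hs.le (by fun_prop))
      (ContinuousOn.circleIntegrable hs.le (by fun_prop)),
      Real.circleAverage_fun_add (ContinuousOn.circleIntegrable hs.le (by fun_prop))
      (ContinuousOn.circleIntegrable hs.le (by fun_prop)), Real.circleAverage_const, hA, ← hmean]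
    exact congrArg₂ _ (congrArg _ (Real.circleAverage_fun_smul (a := β)))
      (Real.circleAverage_fun_smul (a := γ))
  have hle : Real.circleAverage
      (fun z => ‖f 0‖ ^ 2 + 1 * ‖f z‖ ^ 2 + (-2) * (conj (f 0) * f z).re) 0 s ≤
      Real.circleAverage (fun z => s ^ 2 + (s ^ 2 * ‖f 0‖ ^ 2) * ‖f z‖ ^ 2 +
        (-2 * s ^ 2) * (conj (f 0) * f z).re) 0 s := by
    refine Real.circleAverage_mono (ContinuousOn.circleIntegrable hs.le (by fun_prop))
      (ContinuousOn.circleIntegrable hs.le (by fun_prop)) fun z hz => ?_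
    rw [abs_of_pos hs, mem_sphere_zero_iff_norm] at hz
    have h := pow_le_pow_left₀ (norm_nonneg _) (hf.norm_sub_le (hz.trans_lt hs1)) 2
    rw [mul_pow, sq_norm_sub_eq, sq_norm_one_sub_conj_mul_eq, hz] at h
    linarith
  rw [hcomb, hcomb] at hle
  have hpos : 0 ≤ 1 - ‖f 0‖ ^ 2 * s ^ 2 := by
    have : ‖f 0‖ * s ≤ 1 := by nlinarith [norm_nonneg (f 0)]
    nlinarith [mul_nonneg (norm_nonneg (f 0)) hs.le]
  have := mul_le_mul_of_nonneg_right (le_sub_iff_add_le.2 hB) hpos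
  linarith

/-- Cauchy–Schwarz after splitting r = s · (r/s). The choice s² = r/a makes the two factors
proportional for the disk automorphism, so nothing is lost; it needs s < 1, whence r < a. -/
theorem IsAnalyticSelfMap.sum_taylorCoeff_succ_le_of_lt {f : ℂ → ℂ} (hf : IsAnalyticSelfMap f)
    {r : ℝ} (hr : 0 < r) (hra : r < ‖f 0‖) (N : ℕ) :
    (∑ m ∈ Finset.range N, ‖taylorCoeff f (m + 1)‖ * r ^ (m + 1)) * (1 - ‖f 0‖ * r) ≤
      r * (1 - ‖f 0‖ ^ 2) := by
  have h0 : ‖f 0‖ < 1 := hf.norm_lt_one (by simp)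
  set a := ‖f 0‖ with ha
  have ha0 : 0 < a := hr.trans hra
  have hra1 : r / a < 1 := (div_lt_one ha0).2 hra
  have hd : 0 < r / a := div_pos hr ha0
  have har : a * r < 1 := by nlinarith
  set s := √(r / a) with hsdef
  have hs : 0 < s := Real.sqrt_pos.2 hd
  have hs2 : s ^ 2 = r / a := Real.sq_sqrt hd.le
  have hs1 : s < 1 := by
    rw [hsdef, Real.sqrt_lt' one_pos]
    simpa using hra1
  have hU := hf.sum_sq_taylorCoeff_succ_le hs hs1 N
  rw [← ha, hs2, show a ^ 2 * (r / a) = a * r by field_simp] at hU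
  have hV : (∑ m ∈ Finset.range N, (a * r) ^ (m + 1)) * (1 - a * r) ≤ a * r := by
    have : (∑ m ∈ Finset.range N, (a * r) ^ (m + 1)) * (1 - a * r) = a * r * (1 - (a * r) ^ N) := by
      rw [← geom_sum_mul_neg, ← mul_assoc, Finset.mul_sum]
      simp only [pow_succ']
    rw [this]
    have : 0 ≤ (a * r) ^ N := by positivity
    nlinarith [mul_pos ha0 hr]
  have hCS := Finset.sum_mul_sq_le_sq_mul_sq (Finset.range N)
    (fun m => ‖taylorCoeff f (m + 1)‖ * s ^ (m + 1)) (fun m => (r / s) ^ (m + 1))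
  have e1 : ∀ m : ℕ, ‖taylorCoeff f (m + 1)‖ * s ^ (m + 1) * (r / s) ^ (m + 1) =
      ‖taylorCoeff f (m + 1)‖ * r ^ (m + 1) := fun m => by
    rw [mul_assoc, ← mul_pow, mul_div_cancel₀ _ hs.ne']
  have e2 : ∀ m : ℕ, (‖taylorCoeff f (m + 1)‖ * s ^ (m + 1)) ^ 2 =
      ‖taylorCoeff f (m + 1)‖ ^ 2 * (r / a) ^ (m + 1) := fun m => by
    rw [mul_pow, pow_right_comm, hs2]
  have e3 : ∀ m : ℕ, ((r / s) ^ (m + 1)) ^ 2 = (a * r) ^ (m + 1) := fun m => by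
    rw [pow_right_comm, div_pow, hs2]
    congr 1
    field_simp
  simp only [e1, e2, e3] at hCS
  set T := ∑ m ∈ Finset.range N, ‖taylorCoeff f (m + 1)‖ * r ^ (m + 1)
  set U := ∑ m ∈ Finset.range N, ‖taylorCoeff f (m + 1)‖ ^ 2 * (r / a) ^ (m + 1)
  set V := ∑ m ∈ Finset.range N, (a * r) ^ (m + 1)
  have hV0 : 0 ≤ V * (1 - a * r) :=
    mul_nonneg (Finset.sum_nonneg fun m _ => by positivity) (by linarith)
  refine (le_abs_self _).trans (abs_le_of_sq_le_sq ?_ (mul_nonneg hr.le (by nlinarith)))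
  calc (T * (1 - a * r)) ^ 2 = T ^ 2 * (1 - a * r) ^ 2 := mul_pow _ _ _
    _ ≤ U * V * (1 - a * r) ^ 2 := by gcongr
    _ = (U * (1 - a * r)) * (V * (1 - a * r)) := by ring
    _ ≤ (r / a * (1 - a ^ 2) ^ 2) * (a * r) := mul_le_mul hU hV hV0 (by positivity)
    _ = (r * (1 - a ^ 2)) ^ 2 := by field_simp

/-- The endpoints, where s would be 0 or 1, follow by continuity of the finite sums. -/
theorem IsAnalyticSelfMap.sum_taylorCoeff_succ_le {f : ℂ → ℂ} (hf : IsAnalyticSelfMap f)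
    (h0 : 0 < ‖f 0‖) {r : ℝ} (hr : 0 ≤ r) (hra : r ≤ ‖f 0‖) (N : ℕ) :
    (∑ m ∈ Finset.range N, ‖taylorCoeff f (m + 1)‖ * r ^ (m + 1)) * (1 - ‖f 0‖ * r) ≤
      r * (1 - ‖f 0‖ ^ 2) :=
  le_on_closure (s := Ioo 0 ‖f 0‖)
    (f := fun r => (∑ m ∈ Finset.range N, ‖taylorCoeff f (m + 1)‖ * r ^ (m + 1)) *
      (1 - ‖f 0‖ * r)) (g := fun r => r * (1 - ‖f 0‖ ^ 2))
    (fun _ hx => hf.sum_taylorCoeff_succ_le_of_lt hx.1 hx.2 N)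
    (Continuous.continuousOn (by fun_prop)) (Continuous.continuousOn (by fun_prop))
    (by rw [closure_Ioo h0.ne]; exact ⟨hr, hra⟩)

theorem IsAnalyticSelfMap.summable_and_majorant_le {f : ℂ → ℂ} (hf : IsAnalyticSelfMap f)
    (h0 : 0 < ‖f 0‖) {r : ℝ} (hr : 0 ≤ r) (hra : r ≤ ‖f 0‖) :
    Summable (fun n : ℕ => ‖taylorCoeff f n‖ * r ^ n) ∧
      majorant f r ≤ ‖f 0‖ + r * (1 - ‖f 0‖ ^ 2) / (1 - ‖f 0‖ * r) := by
  have h1 : ‖f 0‖ < 1 := hf.norm_lt_one (by simp)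
  have hpos : 0 < 1 - ‖f 0‖ * r := by nlinarith
  have hnn : ∀ n : ℕ, 0 ≤ ‖taylorCoeff f (n + 1)‖ * r ^ (n + 1) := fun n => by positivity
  have hb : ∀ N, ∑ m ∈ Finset.range N, ‖taylorCoeff f (m + 1)‖ * r ^ (m + 1) ≤
      r * (1 - ‖f 0‖ ^ 2) / (1 - ‖f 0‖ * r) := fun N =>
    (le_div_iff₀ hpos).2 (hf.sum_taylorCoeff_succ_le h0 hr hra N)
  have hsum := summable_of_sum_range_le hnn hb
  have hsum' := (summable_nat_add_iff (f := fun n : ℕ => ‖taylorCoeff f n‖ * r ^ n) 1).1 hsum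
  refine ⟨hsum', ?_⟩
  rw [majorant, hsum'.tsum_eq_zero_add, taylorCoeff_zero, pow_zero, mul_one]
  exact add_le_add_right (hsum.tsum_le_of_sum_range_le hb) _

/-! ### The radius as root of a quadratic -/

/-- The left side increases with r ≥ 0, so comparing r with the radius amounts to comparing this
quadratic with 1. -/
theorem radius_quadratic {x : ℝ} (hx : 0 < x) :
    x ^ 2 * radius x ^ 2 + 2 * (1 + x) * radius x = 1 := by
  have h1 : radius x * x ^ 2 = √((1 + x) ^ 2 + x ^ 2) - (1 + x) :=
    div_mul_cancel₀ _ (by positivity)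
  have h2 : (radius x * x ^ 2 + (1 + x)) ^ 2 = (1 + x) ^ 2 + x ^ 2 := by
    rw [h1, sub_add_cancel, Real.sq_sqrt (by positivity)]
  have h3 : x ^ 2 * (x ^ 2 * radius x ^ 2 + 2 * (1 + x) * radius x) = x ^ 2 * 1 := by
    linear_combination h2
  exact mul_left_cancel₀ (by positivity) h3

theorem radius_pos {x : ℝ} (hx : 0 < x) : 0 < radius x := by
  refine div_pos (sub_pos.2 (Real.lt_sqrt_of_sq_lt ?_)) (by positivity)
  nlinarith

theorem radius_lt_one {x : ℝ} (hx : 0 < x) : radius x < 1 := by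
  by_contra! h
  have := radius_quadratic hx
  nlinarith [mul_pos hx hx, mul_le_mul_of_nonneg_left h hx.le, sq_nonneg (x * radius x)]

theorem quadratic_le_one_of_le_radius {x r : ℝ} (hx : 0 < x) (hr : 0 ≤ r) (h : r ≤ radius x) :
    x ^ 2 * r ^ 2 + 2 * (1 + x) * r ≤ 1 := by
  refine le_trans ?_ (radius_quadratic hx).le
  gcongr

theorem one_lt_quadratic_of_radius_lt {x r : ℝ} (hx : 0 < x) (h : radius x < r) :
    1 < x ^ 2 * r ^ 2 + 2 * (1 + x) * r := by
  have := radius_pos hx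
  refine (radius_quadratic hx).ge.trans_lt ?_
  gcongr

/-- The quartic is the radius quadratic, minus 1, evaluated at r = x. -/
theorem radius_le_self {x : ℝ} (hx : 0 < x) (h : 0 ≤ x ^ 4 + 2 * x ^ 2 + 2 * x - 1) :
    radius x ≤ x := by
  by_contra! hlt
  have h1 : x ^ 2 * x ^ 2 + 2 * (1 + x) * x < x ^ 2 * radius x ^ 2 + 2 * (1 + x) * radius x := by
    gcongr
  rw [radius_quadratic hx] at h1
  linarith

/-- The sign of the right side decides both the inequality and its sharpness. -/
theorem one_sub_extremal_sum {x r : ℝ} (h1 : 1 + x * r ≠ 0) (h2 : 1 - x * r ≠ 0) :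
    1 - ((x + r) / (1 + x * r) + r * (1 - x ^ 2) / (1 - x * r)) =
      (1 - x) * (1 - (x ^ 2 * r ^ 2 + 2 * (1 + x) * r)) / ((1 + x * r) * (1 - x * r)) := by
  field_simp
  ring

theorem IsAnalyticSelfMap.norm_add_majorant_sub_le_one {f : ℂ → ℂ} (hf : IsAnalyticSelfMap f)
    (h0 : 0 < ‖f 0‖) (hpoly : 0 ≤ ‖f 0‖ ^ 4 + 2 * ‖f 0‖ ^ 2 + 2 * ‖f 0‖ - 1) {z : ℂ}
    (hz : ‖z‖ ≤ radius ‖f 0‖) :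
    Summable (fun n : ℕ => ‖taylorCoeff f n‖ * ‖z‖ ^ n) ∧
      ‖f z‖ + majorant f ‖z‖ - ‖f 0‖ ≤ 1 := by
  have h1 : ‖f 0‖ < 1 := hf.norm_lt_one (by simp)
  have hz1 : ‖z‖ < 1 := hz.trans_lt (radius_lt_one h0)
  have hq := quadratic_le_one_of_le_radius h0 (norm_nonneg z) hz
  obtain ⟨hs, hm⟩ := hf.summable_and_majorant_le h0 (norm_nonneg z)
    (hz.trans (radius_le_self h0 hpoly))
  have hn := hf.norm_mul_le hz1
  have hr := norm_nonneg z
  refine ⟨hs, ?_⟩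
  set x := ‖f 0‖
  set r := ‖z‖
  have hp : 0 < 1 + x * r := by positivity
  have hp' : 0 < 1 - x * r := by nlinarith
  have hE := one_sub_extremal_sum hp.ne' hp'.ne'
  have hE' : 0 ≤ (1 - x) * (1 - (x ^ 2 * r ^ 2 + 2 * (1 + x) * r)) /
      ((1 + x * r) * (1 - x * r)) :=
    div_nonneg (mul_nonneg (by linarith) (by linarith)) (mul_pos hp hp').le
  have := (le_div_iff₀ hp).2 hn
  linarith

/-! ### Sharpness: the extremal automorphism -/

/-- The disk automorphism `(a - (a / ‖a‖) z) / (1 - ‖a‖ z)`. -/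
noncomputable def extremal (a z : ℂ) : ℂ :=
  a / ‖a‖ * ((‖a‖ - z) / (1 - ‖a‖ * z))

/-- The Taylor coefficients at the origin of `extremal a`. -/
noncomputable def extremalCoeff (a : ℂ) : ℕ → ℂ
  | 0 => a
  | n + 1 => -(a / ‖a‖ * (1 - ‖a‖ ^ 2)) * ‖a‖ ^ n

theorem norm_div_norm_self {a : ℂ} (ha : a ≠ 0) : ‖a / (‖a‖ : ℂ)‖ = 1 := by
  rw [norm_div, Complex.norm_real, norm_norm, div_self (norm_ne_zero_iff.2 ha)]

theorem one_sub_norm_mul_ne_zero {a z : ℂ} (ha : ‖a‖ < 1) (hz : ‖z‖ < 1) :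
    1 - (‖a‖ : ℂ) * z ≠ 0 := by
  simpa using one_sub_conj_mul_ne_zero (b := (‖a‖ : ℂ)) hz (by simpa using ha)

theorem isAnalyticSelfMap_extremal {a : ℂ} (ha0 : a ≠ 0) (ha : ‖a‖ < 1) :
    IsAnalyticSelfMap (extremal a) := by
  refine ⟨?_, fun z hz => ?_⟩
  · rw [Complex.analyticOnNhd_iff_differentiableOn isOpen_ball]
    intro z hz
    have := one_sub_norm_mul_ne_zero ha (mem_ball_zero_iff.1 hz)
    unfold extremal
    fun_prop (disch := assumption)
  · rw [mem_ball_zero_iff] at hz ⊢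
    have hne := one_sub_norm_mul_ne_zero ha hz
    rw [extremal, norm_mul, norm_div_norm_self ha0, one_mul, norm_div,
      div_lt_one (norm_pos_iff.2 hne), norm_sub_rev]
    simpa using norm_sub_lt_norm_one_sub_conj_mul (b := (‖a‖ : ℂ)) hz (by simpa using ha)

theorem hasSum_extremal {a z : ℂ} (ha0 : a ≠ 0) (ha : ‖a‖ < 1) (hz : ‖z‖ < 1) :
    HasSum (fun n => extremalCoeff a n * z ^ n) (extremal a z) := by
  have hne := one_sub_norm_mul_ne_zero ha hz
  have hn : (‖a‖ : ℂ) ≠ 0 := by simpa using ha0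
  have hlt : ‖(‖a‖ : ℂ) * z‖ < 1 := by
    rw [norm_mul, Complex.norm_real, norm_norm]
    nlinarith [norm_nonneg a, norm_nonneg z]
  have h := (hasSum_geometric_of_norm_lt_one hlt).mul_left (-(a / ‖a‖ * (1 - ‖a‖ ^ 2)) * z)
  rw [← hasSum_nat_add_iff' 1]
  convert! h using 1
  · ext n
    simp only [extremalCoeff, mul_pow]
    ring
  · simp only [Finset.sum_range_one, extremalCoeff, extremal]
    field_simp
    ring

theorem taylorCoeff_extremal {a : ℂ} (ha0 : a ≠ 0) (ha : ‖a‖ < 1) (n : ℕ) :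
    taylorCoeff (extremal a) n = extremalCoeff a n := by
  refine taylorCoeff_eq_of_hasSum ?_ n
  filter_upwards [ball_mem_nhds (0 : ℂ) one_pos] with z hz
  exact hasSum_extremal ha0 ha (mem_ball_zero_iff.1 hz)

theorem majorant_extremal {a : ℂ} (ha0 : a ≠ 0) (ha : ‖a‖ < 1) {r : ℝ} (hr : 0 ≤ r)
    (hr1 : r < 1) :
    majorant (extremal a) r = ‖a‖ + r * (1 - ‖a‖ ^ 2) / (1 - ‖a‖ * r) := by
  have hlt : ‖a‖ * r < 1 := by nlinarith [norm_nonneg a]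
  have h := (hasSum_geometric_of_lt_one (mul_nonneg (norm_nonneg a) hr) hlt).mul_left
    ((1 - ‖a‖ ^ 2) * r)
  have hc : ‖(1 - (‖a‖ : ℂ) ^ 2)‖ = 1 - ‖a‖ ^ 2 := by
    rw [← Complex.ofReal_pow, ← Complex.ofReal_one, ← Complex.ofReal_sub, Complex.norm_real,
      Real.norm_of_nonneg]
    nlinarith [norm_nonneg a]
  refine HasSum.tsum_eq ?_
  rw [← hasSum_nat_add_iff' 1]
  convert! h using 1
  · ext n
    rw [taylorCoeff_extremal ha0 ha, extremalCoeff, norm_mul, norm_neg, norm_mul,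
      norm_div_norm_self ha0, hc, norm_pow, Complex.norm_real, norm_norm, mul_pow]
    ring
  · simp only [Finset.sum_range_one, taylorCoeff_extremal ha0 ha, extremalCoeff]
    ring

/-- At z = -r the upper bound of Schwarz–Pick is an equality. -/
theorem norm_extremal_neg {a : ℂ} (ha0 : a ≠ 0) {r : ℝ} (hr : 0 ≤ r) :
    ‖extremal a (-(r : ℂ))‖ = (‖a‖ + r) / (1 + ‖a‖ * r) := by
  have : ((‖a‖ : ℂ) - -r) / (1 - ‖a‖ * -r) = ((‖a‖ + r) / (1 + ‖a‖ * r) : ℝ) := by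
    push_cast
    ring
  rw [extremal, norm_mul, norm_div_norm_self ha0, one_mul, this, Complex.norm_real,
    Real.norm_of_nonneg (by positivity)]

theorem one_lt_norm_add_majorant_extremal {a : ℂ} (ha0 : a ≠ 0) (ha : ‖a‖ < 1) {r : ℝ}
    (hr : radius ‖a‖ < r) (hr1 : r < 1) :
    1 < ‖extremal a (-(r : ℂ))‖ + majorant (extremal a) r - ‖a‖ := by
  have hx := norm_pos_iff.2 ha0
  have hr0 : 0 ≤ r := ((radius_pos hx).trans hr).le
  have hq := one_lt_quadratic_of_radius_lt hx hr
  rw [norm_extremal_neg ha0 hr0, majorant_extremal ha0 ha hr0 hr1]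
  set x := ‖a‖
  have hp : 0 < 1 + x * r := by positivity
  have hp' : 0 < 1 - x * r := by nlinarith
  have hE := one_sub_extremal_sum hp.ne' hp'.ne'
  have hE' : (1 - x) * (1 - (x ^ 2 * r ^ 2 + 2 * (1 + x) * r)) /
      ((1 + x * r) * (1 - x * r)) < 0 :=
    div_neg_of_neg_of_pos (mul_neg_of_pos_of_neg (by linarith) (by linarith)) (mul_pos hp hp')
  linarith

/-! ### The threshold and the main theorem -/

theorem strictMonoOn_threshold_polynomial :
    StrictMonoOn (fun x : ℝ => x ^ 4 + 2 * x ^ 2 + 2 * x - 1) (Ici 0) := by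
  intro x hx y _ hxy
  have hx : 0 ≤ x := hx
  dsimp only
  gcongr

theorem exists_threshold : ∃ t : ℝ, 0.3611025 < t ∧ t < 0.3611035 ∧
    t ^ 4 + 2 * t ^ 2 + 2 * t - 1 = 0 := by
  -- The endpoints are 0.361103 ± 5·10⁻⁷; the quartic changes sign between them.
  obtain ⟨t, ht, h⟩ := intermediate_value_Ioo (a := (0.3611025 : ℝ)) (b := 0.3611035)
    (f := fun x => x ^ 4 + 2 * x ^ 2 + 2 * x - 1) (by norm_num)
    (Continuous.continuousOn (by fun_prop)) (show (0 : ℝ) ∈ _ by constructor <;> norm_num)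
  exact ⟨t, ht.1, ht.2, h⟩

end BohrIneq

open BohrIneq in
theorem mainTheorem6 :
    ∃ t : ℝ, (0 < t ∧ t < 1 ∧ t ^ 4 + 2 * t ^ 2 + 2 * t - 1 = 0) ∧
      (∀ x : ℝ, 0 < x → x < 1 → x ^ 4 + 2 * x ^ 2 + 2 * x - 1 = 0 → x = t) ∧
      |t - 0.361103| < 0.0000005 ∧
      (∀ f : ℂ → ℂ, BohrIneq.IsAnalyticSelfMap f → t ≤ ‖BohrIneq.taylorCoeff f 0‖ →
        ∀ z : ℂ, ‖z‖ ≤ BohrIneq.radius ‖BohrIneq.taylorCoeff f 0‖ →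
          Summable (fun n : ℕ => ‖BohrIneq.taylorCoeff f n‖ * ‖z‖ ^ n) ∧
          ‖f z‖ + BohrIneq.majorant f ‖z‖ - ‖BohrIneq.taylorCoeff f 0‖ ≤ 1) ∧
      (∀ a : ℂ, t ≤ ‖a‖ → ‖a‖ < 1 →
        0 < BohrIneq.radius ‖a‖ ∧ BohrIneq.radius ‖a‖ < 1 ∧
        ∃ f : ℂ → ℂ, BohrIneq.IsAnalyticSelfMap f ∧ BohrIneq.taylorCoeff f 0 = a ∧
          ∀ r : ℝ, BohrIneq.radius ‖a‖ < r → r < 1 →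
            ∃ z : ℂ, ‖z‖ = r ∧
              1 < ‖f z‖ + BohrIneq.majorant f r - ‖BohrIneq.taylorCoeff f 0‖) := by
  obtain ⟨t, h1, h2, h3⟩ := exists_threshold
  have ht : 0 < t := by linarith
  refine ⟨t, ⟨ht, by linarith, h3⟩, fun x hx _ h => ?_, ?_, fun f hf hft z hz => ?_,
    fun a hta ha => ?_⟩
  · exact strictMonoOn_threshold_polynomial.injOn hx.le ht.le (h.trans h3.symm)
  · rw [abs_lt]
    constructor <;> linarith
  · rw [taylorCoeff_zero] at hft hz ⊢
    have h0 := ht.trans_le hft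
    refine hf.norm_add_majorant_sub_le_one h0 ?_ hz
    rw [← h3]
    exact strictMonoOn_threshold_polynomial.monotoneOn ht.le h0.le hft
  · have hx := ht.trans_le hta
    have ha0 := norm_pos_iff.1 hx
    have hc : taylorCoeff (extremal a) 0 = a := taylorCoeff_extremal ha0 ha 0
    refine ⟨radius_pos hx, radius_lt_one hx, extremal a, isAnalyticSelfMap_extremal ha0 ha, hc,
      fun r hr hr1 => ⟨-r, ?_, ?_⟩⟩
    · rw [norm_neg, Complex.norm_real, Real.norm_of_nonneg ((radius_pos hx).trans hr).le]
    · rw [hc]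
      exact one_lt_norm_add_majorant_extremal ha0 ha hr hr1
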